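/- For nonnegative integers $a,k$ with $a<q^k$, the interval $\bigl[\frac{a}{q^k},\frac{a+1}{q^k}\bigr)$ is called basic in base $q$; a basic box in $[0,1]^d$ is a product of $d$ basic intervals. A finite set $P\subset[0,1]^d$ is an $(m,\varepsilon)$-almost net in base $q$ if $|P|=q^n m$ for some integer $n\ge 0$ and $(1-\varepsilon)m\le|\beta\cap P|\le(1+\varepsilon)m$ for every basic box $\beta$ of volume $q^{-n}$. Theorem. Let $q$ be a prime and $d\ge 2$ an integer. (1) For all positive integers $m,n$ with $m\ge 400\,d\log(dq)$ there is a set $P\subset[0,1]^d$ of size $mq^n$ such that, for every basic box $\beta$ (in base $q$) of volume $q^{-n}$, $$\Bigl(1-10\sqrt{\tfrac{d\log(dq)}{m}}\Bigr)m\le|\beta\cap P|\le\Bigl(1+10\sqrt{\tfrac{d\log(dq)}{m}}\Bigr)m,$$ and such that, moreover, the same set $P$ is an $(M,0)$-almost net in base $q$ for some integer $M\le d^{4d}q^{6d}m$. (2) For every real $0<\varepsilon<1/2$ there is a positive integer $m\le 100\,\varepsilon^{-2}d\log(dq)$ for which there exist arbitrarily large $(m,\varepsilon)$-almost nets in $[0,1]^d$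 in base $q$. -/

import Mathlib

open MeasureTheory
open scoped ENNReal

/-- A basic interval in base `q`: a subinterval of `[0,1]` of the form `[a/q^k, (a+1)/q^k)` with
nonnegative integers `a` and `k`; it lies in `[0,1]` exactly when `a < q^k`. -/
def IsBasicInterval (q : ℕ) (I : Set ℝ) : Prop :=
  ∃ a k : ℕ, a < q ^ k ∧ I = Set.Ico ((a : ℝ) / (q : ℝ) ^ k) (((a : ℝ) + 1) / (q : ℝ) ^ k)

/-- A basic box in base `q`: a product of basic intervals. -/
def IsBasicBox (q : ℕ) {d : ℕ} (β : Set (Fin d → ℝ)) : Prop :=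
  ∃ I : Fin d → Set ℝ, (∀ i, IsBasicInterval q (I i)) ∧ β = Set.univ.pi I

/-- Every basic box (in base `q`) of Lebesgue volume `q^{-n}` contains at least `(1 - ε) m` and at
most `(1 + ε) m` points of `P`. -/
def IsEquidistributed (q n : ℕ) {d : ℕ} (m ε : ℝ) (P : Finset (Fin d → ℝ)) : Prop :=
  ∀ β : Set (Fin d → ℝ), IsBasicBox q β → volume β = ((q : ℝ≥0∞) ^ n)⁻¹ →
    (1 - ε) * m ≤ ((β ∩ (P : Set (Fin d → ℝ))).ncard : ℝ) ∧
      ((β ∩ (P : Set (Fin d → ℝ))).ncard : ℝ) ≤ (1 + ε) * m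

/-- A finite set `P ⊆ [0,1]^d` is an `(m, ε)`-almost net in base `q` if `|P| = q^n m` for some
natural number `n` and every basic box of volume `q^{-n}` contains between `(1 - ε) m` and
`(1 + ε) m` points of `P`. -/
def IsAlmostNet (q : ℕ) {d : ℕ} (m ε : ℝ) (P : Finset (Fin d → ℝ)) : Prop :=
  (P : Set (Fin d → ℝ)) ⊆ Set.Icc 0 1 ∧
    ∃ n : ℕ, (P.card : ℝ) = (q : ℝ) ^ n * m ∧ IsEquidistributed q n m ε P

/-! Polynomials over the field with `q` elements become points of the cube: take pairwise coprime
monic `p i`, all of degree `e`, and let coordinate `i` of `f` have as base `q` digits the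
coefficients of the `p i`-adic expansion of `f`. A basic box of volume `q^{-n}` prescribes the first
`k i` digits in each coordinate `i`, with `∑ k i = n`. If every `k i` were a multiple of `e`, this
would be a single congruence modulo a polynomial of degree `n`; in general, rounding the `k i` to
multiples of `e` costs at most `e * d` degrees either way.

So let `D = n - e * d` and `D + t = n + e * d`, and consider polynomials of degree `< D + t`. By the
Chinese remainder theorem every box contains the expected number of them, and two in the same box
that share their top `t` coefficients coincide. Choose `K` vectors of top coefficients at random and
keep all polynomials with these tops, with multiplicity. The number of points in a box is then the
number of samples that hit a set `W` of admissible tops, with mean `m`.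

The crux is that, although the boxes grow in number with `n`, the sets `W` do not: `exists_code`
describes each by boundedly many field elements, at most `(d * q) ^ (20 * d)` codes in all. Chernoff
and a union bound (`exists_sample`) therefore succeed for `m` of order `d log(dq) / ε²`. The `D`
lower coefficients are unrestricted, so coarser boxes are met exactly equally often whatever the
sample is (`card_sampled_digit_eq`); this makes the same set an exact net. -/

/-! ### Random samples and Chernoff's inequality -/

theorem sum_exp_card_preimage {α : Type*} [Fintype α] [DecidableEq α] (K : ℕ) (W : Finset α)
    (t : ℝ) :
    ∑ τ : Fin K → α, Real.exp (t * ((Finset.univ.filter fun j => τ j ∈ W).card : ℝ)) =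
      ((Fintype.card α : ℝ) + (W.card : ℝ) * (Real.exp t - 1)) ^ K := by
  have h1 : ∀ τ : Fin K → α, Real.exp (t * ((Finset.univ.filter fun j => τ j ∈ W).card : ℝ)) =
      ∏ j : Fin K, (if τ j ∈ W then Real.exp t else 1) := by
    intro τ
    rw [Finset.prod_ite, Finset.prod_const, Finset.prod_const_one, mul_one, mul_comm,
      Real.exp_nat_mul]
  have h2 : ∑ a : α, (if a ∈ W then Real.exp t else 1) =
      (Fintype.card α : ℝ) + (W.card : ℝ) * (Real.exp t - 1) := by
    have : ∀ a : α, (if a ∈ W then Real.exp t else 1) =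
        1 + (if a ∈ W then (Real.exp t - 1) else 0) := by
      intro a; split_ifs <;> ring
    simp only [this, Finset.sum_add_distrib, Finset.sum_ite_mem, Finset.univ_inter,
      Finset.sum_const, nsmul_eq_mul, Finset.card_univ, mul_one]
  simp only [h1]
  rw [← h2, ← Fintype.piFinset_univ, Finset.sum_prod_piFinset Finset.univ
    (fun (_ : Fin K) a => if a ∈ W then Real.exp t else 1), Finset.prod_const]
  simp

theorem sum_exp_card_preimage_le {α : Type*} [Fintype α] [DecidableEq α] [Nonempty α] {K : ℕ}
    {W : Finset α} {m t : ℝ} (hm : 0 ≤ m) (hW : (K : ℝ) * W.card = m * Fintype.card α)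
    (ht : |t| ≤ 1) :
    ∑ τ : Fin K → α, Real.exp (t * ((Finset.univ.filter fun j => τ j ∈ W).card : ℝ)) ≤
      (Fintype.card α : ℝ) ^ K * Real.exp (m * (t + t ^ 2)) := by
  rw [sum_exp_card_preimage]
  have hα : (0 : ℝ) < Fintype.card α := by exact_mod_cast Fintype.card_pos
  have hle : (W.card : ℝ) ≤ Fintype.card α := by exact_mod_cast Finset.card_le_univ W
  have h0 : (0 : ℝ) ≤ W.card := by positivity
  have hb : (Fintype.card α : ℝ) + (W.card : ℝ) * (Real.exp t - 1) ≤
      Fintype.card α * Real.exp (W.card / Fintype.card α * (Real.exp t - 1)) := by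
    have := Real.add_one_le_exp ((W.card : ℝ) / Fintype.card α * (Real.exp t - 1))
    calc _ = (Fintype.card α : ℝ) * ((W.card : ℝ) / Fintype.card α * (Real.exp t - 1) + 1) := by
          field_simp; ring
      _ ≤ _ := by gcongr
  have hnn : 0 ≤ (Fintype.card α : ℝ) + (W.card : ℝ) * (Real.exp t - 1) := by
    nlinarith [Real.exp_pos t]
  calc _ ≤ (Fintype.card α * Real.exp (W.card / Fintype.card α * (Real.exp t - 1))) ^ K := by
        gcongr
    _ = (Fintype.card α : ℝ) ^ K * Real.exp (m * (Real.exp t - 1)) := by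
        rw [mul_pow, ← Real.exp_nat_mul]
        congr 2
        have : m = (K : ℝ) * W.card / Fintype.card α := by rw [hW]; field_simp
        rw [this]; ring
    _ ≤ _ := by
        have := (abs_le.1 (Real.abs_exp_sub_one_sub_id_le ht)).2
        gcongr
        linarith

/-- A uniformly random sample of `K` elements meets each of few prescribed sets about as often as
expected (Chernoff's inequality and the union bound). -/
theorem exists_sample {α ι : Type*} [Fintype α] [DecidableEq α] [Nonempty α] [Fintype ι]
    (W : ι → Finset α) (S : Finset ι) {K : ℕ} {m ε : ℝ} (hm : 0 ≤ m) (hε : 0 < ε) (hε' : ε ≤ 1)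
    (hW : ∀ c ∈ S, (K : ℝ) * (W c).card = m * Fintype.card α)
    (hι : 2 * (Fintype.card ι : ℝ) < Real.exp (ε ^ 2 * m / 4)) :
    ∃ τ : Fin K → α, ∀ c ∈ S,
      (1 - ε) * m ≤ ((Finset.univ.filter fun j => τ j ∈ W c).card : ℝ) ∧
        ((Finset.univ.filter fun j => τ j ∈ W c).card : ℝ) ≤ (1 + ε) * m := by
  by_contra! hcon
  set X : (Fin K → α) → ι → ℝ := fun τ c => ((Finset.univ.filter fun j => τ j ∈ W c).card : ℝ)
    with hX
  have hα : (0 : ℝ) < (Fintype.card α : ℝ) ^ K := by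
    have : (0 : ℝ) < Fintype.card α := by exact_mod_cast Fintype.card_pos
    positivity
  -- The sign `s` selects the upper or lower tail. With `t = s * ε / 2` the exponent `m (t + t²) - t
  -- (1 + s ε) m` equals `-ε² m / 4`.
  have hsum : ∀ c ∈ S, ∀ s : ℝ, |s| = 1 → ∑ τ : Fin K → α,
      Real.exp (s * (ε / 2) * X τ c - s * (ε / 2) * ((1 + s * ε) * m)) ≤
        (Fintype.card α : ℝ) ^ K * Real.exp (-(ε ^ 2 * m / 4)) := by
    intro c hc s hs
    have hs2 : s ^ 2 = 1 := by rw [← sq_abs, hs, one_pow]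
    have h1 : |s * (ε / 2)| ≤ 1 := by
      rw [abs_mul, hs, one_mul, abs_of_pos (by positivity)]; linarith
    have h2 := sum_exp_card_preimage_le hm (hW c hc) h1
    calc _ = (∑ τ : Fin K → α, Real.exp (s * (ε / 2) * X τ c)) *
          Real.exp (-(s * (ε / 2) * ((1 + s * ε) * m))) := by
          rw [Finset.sum_mul]
          refine Finset.sum_congr rfl fun τ _ => ?_
          rw [← Real.exp_add]; rfl
      _ ≤ ((Fintype.card α : ℝ) ^ K * Real.exp (m * (s * (ε / 2) + (s * (ε / 2)) ^ 2))) *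
          Real.exp (-(s * (ε / 2) * ((1 + s * ε) * m))) := by gcongr
      _ = _ := by
          rw [mul_assoc, ← Real.exp_add]
          congr 2
          linear_combination (-(ε ^ 2 * m / 4)) * hs2
  -- Every sample is assumed to fail for some `c`, and a failure makes one of the two exponentials
  -- at least `1`.
  have hlow : ((Fintype.card α : ℝ) ^ K) ≤ ∑ τ : Fin K → α, ∑ c ∈ S,
      (Real.exp (1 * (ε / 2) * X τ c - 1 * (ε / 2) * ((1 + 1 * ε) * m)) +
        Real.exp (-1 * (ε / 2) * X τ c - -1 * (ε / 2) * ((1 + -1 * ε) * m))) := by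
    have : ((Fintype.card α : ℝ) ^ K) = ∑ τ : Fin K → α, (1 : ℝ) := by simp
    rw [this]
    refine Finset.sum_le_sum fun τ _ => ?_
    obtain ⟨c, hc, h⟩ := hcon τ
    refine le_trans ?_ (Finset.single_le_sum (fun c _ => by positivity) hc)
    by_cases hlt : (1 - ε) * m ≤ X τ c
    · have := h hlt
      refine le_trans (Real.one_le_exp ?_) (le_add_of_nonneg_right (Real.exp_pos _).le)
      have : (1 + ε) * m < X τ c := this
      nlinarith
    · push Not at hlt
      refine le_trans (Real.one_le_exp ?_) (le_add_of_nonneg_left (Real.exp_pos _).le)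
      nlinarith
  rw [Finset.sum_comm] at hlow
  have hup : ∑ c ∈ S, ∑ τ : Fin K → α,
      (Real.exp (1 * (ε / 2) * X τ c - 1 * (ε / 2) * ((1 + 1 * ε) * m)) +
        Real.exp (-1 * (ε / 2) * X τ c - -1 * (ε / 2) * ((1 + -1 * ε) * m))) ≤
      ∑ c ∈ S, 2 * ((Fintype.card α : ℝ) ^ K * Real.exp (-(ε ^ 2 * m / 4))) := by
    refine Finset.sum_le_sum fun c hc => ?_
    rw [Finset.sum_add_distrib]
    have h1 := hsum c hc 1 (by simp)
    have h2 := hsum c hc (-1) (by simp)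
    linarith
  rw [Finset.sum_const, nsmul_eq_mul] at hup
  have hS : (S.card : ℝ) ≤ Fintype.card ι := by exact_mod_cast Finset.card_le_univ S
  have hE : Real.exp (ε ^ 2 * m / 4) * Real.exp (-(ε ^ 2 * m / 4)) = 1 := by
    rw [← Real.exp_add]; simp
  have hpos := Real.exp_pos (-(ε ^ 2 * m / 4))
  have h3 : 2 * (S.card : ℝ) * Real.exp (-(ε ^ 2 * m / 4)) < 1 := by
    rw [← hE]
    gcongr
    linarith
  have := hlow.trans hup
  nlinarith

/-! ### Pairwise coprime moduli of equal degree -/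

open Polynomial in
-- Minimal polynomials of elements of the field with `q ^ e` elements have degree dividing `e`, and
-- each is shared by at most `e` elements, so at least `q ^ e / e ≥ d` of them are distinct.
-- Suitable powers bring all degrees to exactly `e` and preserve coprimality.
theorem exists_pairwise_coprime_monic (q d e : ℕ) [Fact q.Prime] (he : 0 < e)
    (h : e * d ≤ q ^ e) : ∃ p : Fin d → (ZMod q)[X],
      (∀ i, (p i).Monic) ∧ (∀ i, (p i).natDegree = e) ∧ Pairwise fun i j => IsCoprime (p i) (p j) := by
  classical
  let K := GaloisField q e
  have : Fintype K := Fintype.ofFinite K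
  have hcard : Fintype.card K = q ^ e := by
    rw [← Nat.card_eq_fintype_card]; exact GaloisField.card q e he.ne'
  have hrank : Module.finrank (ZMod q) K = e := GaloisField.finrank q he.ne'
  have hint : ∀ x : K, IsIntegral (ZMod q) x := fun x => Algebra.IsIntegral.isIntegral x
  have hdeg : ∀ x : K, (minpoly (ZMod q) x).natDegree ∣ e := fun x => 
    (minpoly.degree_dvd (hint x)).trans (dvd_of_eq hrank)
  let M : Finset (ZMod q)[X] := Finset.univ.image fun x : K => minpoly (ZMod q) x
  have hM : d ≤ M.card := by
    have h1 : (Finset.univ : Finset K).card ≤ e * M.card := by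
      refine Finset.card_le_mul_card_image _ _ fun b hb => ?_
      obtain ⟨y, -, rfl⟩ := Finset.mem_image.1 hb
      have h0 : minpoly (ZMod q) y ≠ 0 := minpoly.ne_zero (hint y)
      calc _ ≤ ((minpoly (ZMod q) y).aroots K).toFinset.card := by
            refine Finset.card_le_card fun x hx => ?_
            rw [Multiset.mem_toFinset, mem_aroots]
            refine ⟨h0, ?_⟩
            rw [← (Finset.mem_filter.1 hx).2]
            exact minpoly.aeval _ _
        _ ≤ ((minpoly (ZMod q) y).map (algebraMap (ZMod q) K)).natDegree :=
            (Multiset.toFinset_card_le _).trans (card_roots' _)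
        _ = (minpoly (ZMod q) y).natDegree := natDegree_map _
        _ ≤ e := Nat.le_of_dvd he (hdeg y)
    rw [Finset.card_univ, hcard] at h1
    exact Nat.le_of_mul_le_mul_left (h.trans h1) he
  obtain ⟨g⟩ : Nonempty (Fin d ↪ M) := by
    rw [Function.Embedding.nonempty_iff_card_le]; simpa using hM
  have hg : ∀ i, ∃ x : K, minpoly (ZMod q) x = (g i : (ZMod q)[X]) := fun i => by
    obtain ⟨x, -, hx⟩ := Finset.mem_image.1 (g i).2
    exact ⟨x, hx⟩
  refine ⟨fun i => (g i : (ZMod q)[X]) ^ (e / (g i : (ZMod q)[X]).natDegree), fun i => ?_,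
    fun i => ?_, fun i j hij => ?_⟩
  · obtain ⟨x, hx⟩ := hg i
    simp only [← hx]; exact (minpoly.monic (hint x)).pow _
  · obtain ⟨x, hx⟩ := hg i
    simp only [← hx]
    rw [(minpoly.monic (hint x)).natDegree_pow, Nat.div_mul_cancel (hdeg x)]
  · obtain ⟨x, hx⟩ := hg i
    obtain ⟨y, hy⟩ := hg j
    have hne : minpoly (ZMod q) x ≠ minpoly (ZMod q) y := fun h =>
      hij (g.injective (Subtype.ext (by rw [← hx, ← hy, h])))
    simp only [← hx, ← hy]
    refine IsCoprime.pow ?_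
    refine ((minpoly.irreducible (hint x)).coprime_iff_not_dvd).2 fun hdvd => hne ?_
    exact eq_of_monic_of_associated (minpoly.monic (hint x)) (minpoly.monic (hint y))
      ((minpoly.irreducible (hint x)).associated_of_dvd (minpoly.irreducible (hint y)) hdvd)

/-! ### Digits of polynomials and the Chinese remainder theorem -/

open Polynomial in
/-- The `l`-th digit of `f` with respect to `p`: the coefficients of the `p`-adic expansion of `f`,
listed one after the other. -/
noncomputable def digit {F : Type*} [Field F] (p : F[X]) (l : ℕ) (f : F[X]) : F :=
  ((f /ₘ p ^ (l / p.natDegree)) %ₘ p).coeff (l % p.natDegree)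

open Polynomial in
theorem add_divByMonic_of_monic {F : Type*} [Field F] {p : F[X]} (hp : p.Monic) (f g : F[X]) :
    (f + g) /ₘ p = f /ₘ p + g /ₘ p := by
  refine (div_modByMonic_unique _ (f %ₘ p + g %ₘ p) hp ⟨?_, ?_⟩).1
  · linear_combination modByMonic_add_div f p + modByMonic_add_div g p
  · exact (degree_add_le _ _).trans_lt
      (max_lt (degree_modByMonic_lt _ hp) (degree_modByMonic_lt _ hp))

open Polynomial in
theorem digit_add {F : Type*} [Field F] {p : F[X]} (hp : p.Monic) (l : ℕ) (f g : F[X]) :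
    digit p l (f + g) = digit p l f + digit p l g := by
  simp [digit, add_divByMonic_of_monic (hp.pow _), add_modByMonic]

open Polynomial in
theorem digit_sub {F : Type*} [Field F] {p : F[X]} (hp : p.Monic) (l : ℕ) (f g : F[X]) :
    digit p l (f - g) = digit p l f - digit p l g := by
  rw [eq_sub_iff_add_eq, ← digit_add hp, sub_add_cancel]

open Polynomial in
theorem digit_pow_mul {F : Type*} [Field F] {p : F[X]} (hp : p.Monic) {l : ℕ}
    (hl : l < p.natDegree) (j : ℕ) (g : F[X]) :
    digit p (p.natDegree * j + l) (p ^ j * g) = (g %ₘ p).coeff l := by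
  have h0 : 0 < p.natDegree := by omega
  rw [digit, Nat.mul_add_div h0, Nat.div_eq_of_lt hl, Nat.add_zero, Nat.mul_add_mod,
    Nat.mod_eq_of_lt hl, mul_divByMonic_cancel_left _ (hp.pow _)]

open Polynomial in
theorem forall_digit_eq_zero_iff {F : Type*} [Field F] {p : F[X]} (hp : p.Monic)
    (hp' : 0 < p.natDegree) (j : ℕ) (f : F[X]) :
    (∀ l < p.natDegree * j, digit p l f = 0) ↔ p ^ j ∣ f := by
  induction j with
  | zero => simp
  | succ j ih =>
    constructor
    · intro h
      obtain ⟨g, rfl⟩ := ih.1 fun l hl => h l (by rw [mul_add]; omega)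
      rw [pow_succ]
      refine mul_dvd_mul_left _ ((modByMonic_eq_zero_iff_dvd hp).1 ?_)
      ext l
      by_cases hl : l < p.natDegree
      · rw [← digit_pow_mul hp hl j g, h _ (by rw [mul_add]; omega), coeff_zero]
      · rw [coeff_zero]
        exact coeff_eq_zero_of_degree_lt ((degree_modByMonic_lt _ hp).trans_le
          (degree_le_of_natDegree_le (not_lt.1 hl)))
    · rintro ⟨g, rfl⟩ l hl
      by_cases h : l < p.natDegree * j
      · exact ih.2 ⟨p * g, by ring⟩ l h
      · obtain ⟨b, rfl⟩ := Nat.exists_eq_add_of_le (not_lt.1 h)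
        rw [mul_add] at hl
        rw [pow_succ, mul_assoc, digit_pow_mul hp (by omega),
          (modByMonic_eq_zero_iff_dvd hp).2 (dvd_mul_right p g), coeff_zero]

open Polynomial in
theorem natDegree_prod_pow {F : Type*} [Field F] {d e : ℕ} {p : Fin d → F[X]}
    (hp : ∀ i, (p i).Monic) (he : ∀ i, (p i).natDegree = e) (J : Fin d → ℕ) :
    (∏ i, p i ^ J i).natDegree = e * ∑ i, J i := by
  rw [natDegree_prod_of_monic _ _ fun i _ => (hp i).pow _, Finset.mul_sum]
  exact Finset.sum_congr rfl fun i _ => by rw [(hp i).natDegree_pow, he i, mul_comm]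

open Polynomial in
theorem prod_pow_dvd_of_forall_digit_eq_zero {F : Type*} [Field F] {d e : ℕ} {p : Fin d → F[X]}
    (hp : ∀ i, (p i).Monic) (he : ∀ i, (p i).natDegree = e) (he0 : 0 < e)
    (hc : Pairwise fun i j => IsCoprime (p i) (p j)) {k J : Fin d → ℕ} (hk : ∀ i, e * J i ≤ k i)
    {f : F[X]} (h : ∀ i, ∀ l < k i, digit (p i) l f = 0) : (∏ i, p i ^ J i) ∣ f := by
  refine Fintype.prod_dvd_of_coprime (fun i j hij => (hc hij).pow) fun i => ?_
  refine (forall_digit_eq_zero_iff (hp i) (by rw [he i]; exact he0) _ f).1 fun l hl => ?_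
  rw [he i] at hl
  exact h i l (hl.trans_le (hk i))

open Polynomial in
theorem card_degreeLT {F : Type*} [Field F] [Fintype F] (n : ℕ) :
    Nat.card (degreeLT F n) = Fintype.card F ^ n := by
  rw [Nat.card_congr (degreeLTEquiv F n).toEquiv]; simp

instance {F : Type*} [Field F] [Fintype F] (n : ℕ) : Finite (Polynomial.degreeLT F n) :=
  .of_equiv _ (Polynomial.degreeLTEquiv F n).toEquiv.symm

open Polynomial in
theorem eq_zero_of_dvd_of_mem_degreeLT {F : Type*} [Field F] {G f : F[X]} {D : ℕ}
    (hG : D ≤ G.natDegree) (h : G ∣ f) (hf : f ∈ degreeLT F D) : f = 0 := by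
  by_contra h0
  rw [mem_degreeLT, degree_eq_natDegree h0, Nat.cast_lt] at hf
  have := natDegree_le_of_dvd h h0
  omega

open Polynomial in
-- Reading off complete blocks of digits is injective in degree below `e * ∑ J i`, since a
-- difference with zero digits is divisible by a product of that degree. Source and target have the
-- same size, so it is also surjective.
theorem exists_digit_eq {F : Type*} [Field F] [Fintype F] {d e : ℕ} {p : Fin d → F[X]}
    (hp : ∀ i, (p i).Monic) (he : ∀ i, (p i).natDegree = e) (he0 : 0 < e)
    (hc : Pairwise fun i j => IsCoprime (p i) (p j)) {k J : Fin d → ℕ} (hk : ∀ i, k i ≤ e * J i)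
    {D : ℕ} (hD : e * ∑ i, J i ≤ D) (c : Fin d → ℕ → F) :
    ∃ f ∈ degreeLT F D, ∀ i, ∀ l < k i, digit (p i) l f = c i l := by
  set G := ∏ i, p i ^ J i with hG
  have hdeg : G.natDegree = e * ∑ i, J i := natDegree_prod_pow hp he J
  let Λ : degreeLT F G.natDegree → ((i : Fin d) → Fin (e * J i) → F) :=
    fun f i l => digit (p i) l (f : F[X])
  have hinj : Function.Injective Λ := by
    intro f g hfg
    rw [Subtype.ext_iff, ← sub_eq_zero]
    refine eq_zero_of_dvd_of_mem_degreeLT le_rfl ?_ (Submodule.sub_mem _ f.2 g.2)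
    refine prod_pow_dvd_of_forall_digit_eq_zero hp he he0 hc (fun i => le_rfl) fun i l hl => ?_
    rw [digit_sub (hp i), sub_eq_zero]
    exact congrFun (congrFun hfg i) ⟨l, hl⟩
  have hcard : Nat.card (degreeLT F G.natDegree) =
      Nat.card ((i : Fin d) → Fin (e * J i) → F) := by
    rw [card_degreeLT, hdeg, Nat.card_pi]
    simp [Finset.prod_pow_eq_pow_sum, Finset.mul_sum]
  obtain ⟨f, hf⟩ := ((Nat.bijective_iff_injective_and_card Λ).2 ⟨hinj, hcard⟩).2 fun i l => c i l
  refine ⟨f, degreeLT_mono (hdeg ▸ hD) f.2, fun i l hl => ?_⟩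
  exact congrFun (congrFun hf i) ⟨l, hl.trans_le (hk i)⟩

open Polynomial in
/-- Prescribing digits cuts out the expected proportion of the polynomials of degree `< D`. -/
theorem card_digit_eq {F : Type*} [Field F] [Fintype F] {d e : ℕ} {p : Fin d → F[X]}
    (hp : ∀ i, (p i).Monic) (he : ∀ i, (p i).natDegree = e) (he0 : 0 < e)
    (hc : Pairwise fun i j => IsCoprime (p i) (p j)) {k J : Fin d → ℕ} (hk : ∀ i, k i ≤ e * J i)
    {D : ℕ} (hD : e * ∑ i, J i ≤ D) (c : Fin d → ℕ → F) :
    Nat.card {f : degreeLT F D // ∀ i, ∀ l < k i, digit (p i) l (f : F[X]) = c i l} =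
      Fintype.card F ^ (D - ∑ i, k i) := by
  let Λ : degreeLT F D →+ ((i : Fin d) → Fin (k i) → F) :=
    { toFun := fun f i l => digit (p i) l (f : F[X])
      map_zero' := by
        ext i l
        have := digit_sub (hp i) l (0 : F[X]) 0
        simpa using this
      map_add' := fun f g => by
        ext i l
        exact digit_add (hp i) l _ _ }
  have hsurj : Function.Surjective Λ := by
    intro y
    obtain ⟨f, hf, h⟩ := exists_digit_eq hp he he0 hc hk hD
      fun i l => if hl : l < k i then y i ⟨l, hl⟩ else 0
    refine ⟨⟨f, hf⟩, ?_⟩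
    ext i l
    exact (h i l l.2).trans (by simp)
  have hfib : ∀ y, Nat.card (Λ ⁻¹' {y}) = Nat.card Λ.ker := fun y =>
    Nat.card_congr (AddMonoidHom.fiberEquivKerOfSurjective hsurj y)
  have hker : Nat.card Λ.ker * Fintype.card F ^ (∑ i, k i) = Fintype.card F ^ D := by
    have h1 := Λ.ker.card_mul_index
    rw [AddSubgroup.index_ker, AddMonoidHom.range_eq_top.2 hsurj, card_degreeLT,
      AddSubgroup.card_top, Nat.card_pi] at h1
    simpa [Finset.prod_pow_eq_pow_sum] using h1
  have hle : ∑ i, k i ≤ D := by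
    refine le_trans ?_ hD
    rw [Finset.mul_sum]
    exact Finset.sum_le_sum fun i _ => hk i
  have hF : 0 < Fintype.card F := Fintype.card_pos
  have hfin : Nat.card Λ.ker = Fintype.card F ^ (D - ∑ i, k i) := by
    refine Nat.eq_of_mul_eq_mul_right (pow_pos hF (∑ i, k i)) ?_
    rw [hker, ← pow_add, Nat.sub_add_cancel hle]
  rw [← hfin, ← hfib fun i l => c i l]
  refine Nat.card_congr (Equiv.subtypeEquivRight fun f => ?_)
  constructor
  · intro h
    rw [Set.mem_preimage, Set.mem_singleton_iff]
    ext i l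
    exact h i l l.2
  · intro h i l hl
    exact congrFun (congrFun h i) ⟨l, hl⟩

/-! ### Boundedly many codes for the leading coefficients in a box -/

open Polynomial in
/-- The finitely many data that determine the possible leading coefficients of the polynomials
in a box. -/
abbrev BoxCode (F : Type*) [Field F] (d e t : ℕ) : Type _ :=
  (Fin (2 * t) → F) × Fin (t + 1) × (Fin d → degreeLT F e) × (Fin d → Fin e) × (Fin t → F)

open Polynomial in
/-- The set of vectors of leading coefficients described by a code. -/
def BoxCode.toSet {F : Type*} [Field F] {d e t : ℕ} (p : Fin d → F[X]) :
    BoxCode F d e t → Set (Fin t → F)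
  | (g, s, u, r, v) => {w | ∃ h ∈ degreeLT F s,
      (∀ i, ∀ l < (r i : ℕ), (((u i : F[X]) * h) %ₘ p i).coeff l = 0) ∧
      ∀ c : Fin t, w c = v c + ∑ b : Fin t, g ⟨c + t - b, by omega⟩ * h.coeff b}

theorem card_boxCode_le {F : Type*} [Field F] [Fintype F] {d e t : ℕ} (ht : t ≤ 2 * (e * d)) :
    Nat.card (BoxCode F d e t) ≤ (Fintype.card F ^ e) ^ (10 * d) := by
  have hF : 2 ≤ Fintype.card F := Fintype.one_lt_card
  have hF1 : 1 ≤ Fintype.card F := by omega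
  have hpow : ∀ a, a < Fintype.card F ^ a := fun a => Nat.lt_pow_self hF
  simp only [Nat.card_prod, Nat.card_pi, card_degreeLT]
  simp only [Nat.card_eq_fintype_card, Fintype.card_fin, Finset.prod_const, Finset.card_univ]
  calc _ ≤ Fintype.card F ^ (2 * t) * (Fintype.card F ^ t * ((Fintype.card F ^ e) ^ d *
        ((Fintype.card F ^ e) ^ d * Fintype.card F ^ t))) := by
        gcongr
        · exact hpow t
        · exact (hpow e).le
    _ = Fintype.card F ^ (4 * t + 2 * (e * d)) := by
        rw [← pow_mul, ← pow_add, ← pow_add, ← pow_add, ← pow_add]; ring_nf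
    _ ≤ Fintype.card F ^ (e * (10 * d)) := by
        refine Nat.pow_le_pow_right hF1 ?_
        have : e * (10 * d) = 10 * (e * d) := by ring
        omega
    _ = _ := pow_mul _ _ _

open Polynomial in
theorem mul_mem_degreeLT_iff {F : Type*} [Field F] {G h : F[X]} (hG : G.Monic) {s : ℕ} :
    G * h ∈ degreeLT F (G.natDegree + s) ↔ h ∈ degreeLT F s := by
  rcases eq_or_ne h 0 with rfl | h0
  · simp
  · rw [mem_degreeLT, mem_degreeLT, degree_eq_natDegree (mul_ne_zero hG.ne_zero h0),
      degree_eq_natDegree h0, natDegree_mul hG.ne_zero h0, Nat.cast_lt, Nat.cast_lt]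
    omega

open Polynomial in
-- Only a window of `2 * t` coefficients of `G` matters. The factor `X ^ t` shifts it so that no
-- index becomes negative when `D < t`.
theorem coeff_mul_of_mem_degreeLT {F : Type*} [Field F] {G h : F[X]} {s t : ℕ}
    (hst : s ≤ t) (hh : h ∈ degreeLT F s) (D c : ℕ) :
    (G * h).coeff (D + c) = ∑ b : Fin t, (G * X ^ t).coeff (D + (c + t - b)) * h.coeff b := by
  have hh' := degreeLT_mono hst hh
  rw [mem_degreeLT, degree_lt_iff_coeff_zero] at hh'
  rw [← coeff_mul_X_pow _ t, mul_right_comm]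
  generalize G * X ^ t = A
  rw [mul_comm, coeff_mul,
    Fin.sum_univ_eq_sum_range (fun b : ℕ => A.coeff (D + (c + t - b)) * h.coeff b) t,
    Finset.Nat.sum_antidiagonal_eq_sum_range_succ (fun i j : ℕ => h.coeff i * A.coeff j)]
  symm
  refine Finset.sum_subset_zero_on_sdiff (by intro b; simp; omega) (fun b hb => ?_) fun b hb => ?_
  · rw [hh' b (by simp at hb; omega), zero_mul]
  · rw [mul_comm, show D + c + t - b = D + (c + t - b) by have := Finset.mem_range.1 hb; omega]

open Polynomial in
-- The polynomials in the box are `f₀ + G * h`, where `G` collects the complete blocks and `h` has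
-- degree below `s = D + t - deg G ≤ t`. The incomplete block at `i` constrains only the lowest `k i
-- % e` coefficients of `H i * h` modulo `p i`, where `H i` is the part of `G` prime to `p i`; so `H
-- i` matters only through its residue.
theorem exists_code {F : Type*} [Field F] {d e : ℕ} {p : Fin d → F[X]}
    (hp : ∀ i, (p i).Monic) (he : ∀ i, (p i).natDegree = e) (he0 : 0 < e)
    (hc : Pairwise fun i j => IsCoprime (p i) (p j)) {k : Fin d → ℕ} {D t : ℕ}
    (hD : D ≤ e * ∑ i, k i / e) (hD' : e * ∑ i, k i / e ≤ D + t) {c : Fin d → ℕ → F} {f₀ : F[X]}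
    (hf₀ : f₀ ∈ degreeLT F (D + t)) (hf₀' : ∀ i, ∀ l < k i, digit (p i) l f₀ = c i l) :
    ∃ κ : BoxCode F d e t, ∀ w, w ∈ κ.toSet p ↔ ∃ f ∈ degreeLT F (D + t),
      (∀ i, ∀ l < k i, digit (p i) l f = c i l) ∧ ∀ y : Fin t, w y = f.coeff (D + y) := by
  set G := ∏ i, p i ^ (k i / e) with hG
  have hGm : G.Monic := monic_prod_of_monic _ _ fun i _ => (hp i).pow _
  have hdeg : G.natDegree = e * ∑ i, k i / e := natDegree_prod_pow hp he _
  obtain ⟨s, hs⟩ := Nat.exists_eq_add_of_le (hdeg ▸ hD')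
  let H : Fin d → F[X] := fun i => ∏ j ∈ Finset.univ.erase i, p j ^ (k j / e)
  have hH : ∀ i, G = p i ^ (k i / e) * H i := fun i =>
    (Finset.mul_prod_erase _ _ (Finset.mem_univ i)).symm
  have hmod : ∀ i (h : F[X]), ((H i %ₘ p i) * h) %ₘ p i = (H i * h) %ₘ p i := fun i h => by
    refine modByMonic_eq_of_dvd_sub (hp i) ?_
    rw [← sub_mul]
    exact (dvd_modByMonic_sub _ _).mul_right _
  have hzero : ∀ h : F[X], (∀ i, ∀ l < k i, digit (p i) l (G * h) = 0) ↔
      ∀ i, ∀ l < k i % e, (((H i %ₘ p i) * h) %ₘ p i).coeff l = 0 := fun h => by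
    refine forall_congr' fun i => ?_
    have hk := Nat.div_add_mod (k i) e
    have hlt := Nat.mod_lt (k i) he0
    have key : ∀ l < e, digit (p i) (e * (k i / e) + l) (G * h) =
        (((H i %ₘ p i) * h) %ₘ p i).coeff l := fun l hl => by
      have := digit_pow_mul (hp i) (by rw [he i]; exact hl) (k i / e) (H i * h)
      rw [he i] at this
      rw [hmod, ← this, hH i, mul_assoc]
    constructor
    · intro hz l hl
      rw [← key l (by omega)]
      exact hz _ (by omega)
    · intro hz l hl
      by_cases hle : l < e * (k i / e)
      · refine (forall_digit_eq_zero_iff (hp i) (by rw [he i]; exact he0) (k i / e) _).2 ?_ l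
          (by rw [he i]; exact hle)
        rw [hH i, mul_assoc]; exact dvd_mul_right _ _
      · obtain ⟨b, rfl⟩ := Nat.exists_eq_add_of_le (not_lt.1 hle)
        rw [key b (by omega)]
        exact hz b (by omega)
  refine ⟨(fun y => (G * X ^ t).coeff (D + y), ⟨s, by omega⟩,
    fun i => ⟨H i %ₘ p i, mem_degreeLT.2 ?_⟩, fun i => ⟨k i % e, Nat.mod_lt _ he0⟩,
    fun y => f₀.coeff (D + y)), fun w => ?_⟩
  · rw [← he i, ← degree_eq_natDegree (hp i).ne_zero]
    exact degree_modByMonic_lt _ (hp i)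
  constructor
  · rintro ⟨h, hh, hz, hw⟩
    refine ⟨f₀ + G * h, ?_, fun i l hl => ?_, fun y => ?_⟩
    · exact Submodule.add_mem _ hf₀ (hs ▸ (mul_mem_degreeLT_iff hGm).2 hh)
    · rw [digit_add (hp i), hf₀' i l hl, (hzero h).2 hz i l hl, add_zero]
    · rw [hw, coeff_add, coeff_mul_of_mem_degreeLT (s := s) (t := t) (by omega) hh]
  · rintro ⟨f, hf, hfc, hw⟩
    have hdvd : G ∣ f - f₀ := by
      refine prod_pow_dvd_of_forall_digit_eq_zero hp he he0 hc
        (fun i => Nat.mul_div_le (k i) e) fun i l hl => ?_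
      rw [digit_sub (hp i), hfc i l hl, hf₀' i l hl, sub_self]
    obtain ⟨h, hh⟩ := hdvd
    have hhm : h ∈ degreeLT F s :=
      (mul_mem_degreeLT_iff hGm).1 (hs ▸ hh ▸ Submodule.sub_mem _ hf hf₀)
    refine ⟨h, hhm, (hzero h).1 fun i l hl => ?_, fun y => ?_⟩
    · rw [← hh, digit_sub (hp i), hfc i l hl, hf₀' i l hl, sub_self]
    · change w y = f₀.coeff (D + y) + ∑ b : Fin t, (G * X ^ t).coeff (D + (y + t - b)) * h.coeff b
      rw [hw, ← coeff_mul_of_mem_degreeLT (s := s) (t := t) (by omega) hhm, ← hh, coeff_sub]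
      ring

open Polynomial in
-- The difference has degree below `D` and is divisible by a product of degree at least `D`. Hence
-- each sample contributes at most one point to a box.
theorem eq_of_coeff_eq_of_digit_eq {F : Type*} [Field F] {d e : ℕ} {p : Fin d → F[X]}
    (hp : ∀ i, (p i).Monic) (he : ∀ i, (p i).natDegree = e) (he0 : 0 < e)
    (hc : Pairwise fun i j => IsCoprime (p i) (p j)) {k : Fin d → ℕ} {D t : ℕ}
    (hD : D ≤ e * ∑ i, k i / e) {f f' : F[X]} (hf : f ∈ degreeLT F (D + t))
    (hf' : f' ∈ degreeLT F (D + t)) (h : ∀ i, ∀ l < k i, digit (p i) l f = digit (p i) l f')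
    (hcoeff : ∀ y : Fin t, f.coeff (D + y) = f'.coeff (D + y)) : f = f' := by
  rw [← sub_eq_zero]
  refine eq_zero_of_dvd_of_mem_degreeLT (G := ∏ i, p i ^ (k i / e)) (D := D)
    (by rwa [natDegree_prod_pow hp he]) ?_ ?_
  · refine prod_pow_dvd_of_forall_digit_eq_zero hp he he0 hc
      (fun i => Nat.mul_div_le (k i) e) fun i l hl => ?_
    rw [digit_sub (hp i), h i l hl, sub_self]
  · rw [mem_degreeLT, degree_lt_iff_coeff_zero]
    intro l hl
    obtain ⟨y, rfl⟩ := Nat.exists_eq_add_of_le hl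
    rw [coeff_sub, sub_eq_zero]
    by_cases hy : y < t
    · exact hcoeff ⟨y, hy⟩
    · rw [mem_degreeLT, degree_lt_iff_coeff_zero] at hf hf'
      rw [hf _ (by omega), hf' _ (by omega)]

/-! ### Base `q` expansions, basic boxes and points -/

/-- The natural number with base `q` digits `δ 0, …, δ (k - 1)`, the most significant first. -/
def numeral (q : ℕ) (δ : ℕ → ℕ) : ℕ → ℕ
  | 0 => 0
  | k + 1 => q * numeral q δ k + δ k

theorem numeral_lt {q : ℕ} {δ : ℕ → ℕ} (h : ∀ l, δ l < q) (k : ℕ) : numeral q δ k < q ^ k := by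
  induction k with
  | zero => simp [numeral]
  | succ k ih =>
    rw [numeral, pow_succ']
    calc _ < q * numeral q δ k + q := by have := h k; omega
      _ = q * (numeral q δ k + 1) := by ring
      _ ≤ _ := Nat.mul_le_mul_left _ ih

theorem numeral_add_div {q : ℕ} {δ : ℕ → ℕ} (h : ∀ l, δ l < q) (k j : ℕ) :
    numeral q δ (k + j) / q ^ j = numeral q δ k := by
  induction j with
  | zero => simp
  | succ j ih =>
    have hq : 0 < q := (Nat.zero_le _).trans_lt (h 0)
    rw [← ih, pow_succ', ← Nat.div_div_eq_div_mul, ← add_assoc, numeral, Nat.mul_add_div hq,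
      Nat.div_eq_of_lt (h _), add_zero]

theorem numeral_eq_iff {q : ℕ} {δ δ' : ℕ → ℕ} (h : ∀ l, δ l < q) (h' : ∀ l, δ' l < q) (k : ℕ) :
    numeral q δ k = numeral q δ' k ↔ ∀ l < k, δ l = δ' l := by
  induction k with
  | zero => simp [numeral]
  | succ k ih =>
    have hq : 0 < q := (Nat.zero_le _).trans_lt (h 0)
    rw [Nat.forall_lt_succ_right, ← ih, numeral, numeral]
    constructor
    · intro heq
      have h1 := congrArg (· / q) heq
      have h2 := congrArg (· % q) heq
      simp only [Nat.mul_add_div hq, Nat.div_eq_of_lt (h k), Nat.div_eq_of_lt (h' k),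
        Nat.mul_add_mod, Nat.mod_eq_of_lt (h k), Nat.mod_eq_of_lt (h' k), add_zero] at h1 h2
      exact ⟨h1, h2⟩
    · rintro ⟨h1, h2⟩
      rw [h1, h2]

theorem exists_numeral_eq {q : ℕ} (hq : 0 < q) (k a : ℕ) (ha : a < q ^ k) :
    ∃ δ : ℕ → ℕ, (∀ l, δ l < q) ∧ numeral q δ k = a := by
  induction k generalizing a with
  | zero => exact ⟨fun _ => 0, fun _ => hq, by simp at ha; simp [numeral, ha]⟩
  | succ k ih =>
    obtain ⟨δ, h, hδ⟩ := ih (a / q) (Nat.div_lt_of_lt_mul (by rwa [← pow_succ']))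
    have h' : ∀ l, (if l = k then a % q else δ l) < q := fun l => by
      split_ifs
      · exact Nat.mod_lt _ hq
      · exact h l
    refine ⟨fun l => if l = k then a % q else δ l, h', ?_⟩
    have : numeral q (fun l => if l = k then a % q else δ l) k = a / q := by
      rw [← hδ, numeral_eq_iff h' h]
      intro l hl
      simp [hl.ne]
    rw [numeral, this]
    simp [Nat.div_add_mod]

theorem add_div_pow_mem_Ico_iff {q : ℕ} (hq : 0 < q) (A a k j : ℕ) {θ : ℝ} (h0 : 0 ≤ θ)
    (h1 : θ < 1) :
    ((A : ℝ) + θ) / (q : ℝ) ^ (k + j) ∈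
      Set.Ico ((a : ℝ) / (q : ℝ) ^ k) (((a : ℝ) + 1) / (q : ℝ) ^ k) ↔ A / q ^ j = a := by
  have hk : (0 : ℝ) < (q : ℝ) ^ k := by positivity
  have hj : (0 : ℝ) < (q : ℝ) ^ j := by positivity
  have hj' : 0 < q ^ j := by positivity
  have hdiv : A / q ^ j = a ↔ a * q ^ j ≤ A ∧ A < (a + 1) * q ^ j := by
    rw [← Nat.le_div_iff_mul_le hj', ← Nat.div_lt_iff_lt_mul hj']; omega
  rw [pow_add, Set.mem_Ico, mul_comm, ← div_div, div_le_div_iff_of_pos_right hk,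
    div_lt_div_iff_of_pos_right hk, le_div_iff₀ hj, div_lt_iff₀ hj, hdiv]
  constructor
  · rintro ⟨h2, h3⟩
    have h2' : ((a * q ^ j : ℕ) : ℝ) < ((A + 1 : ℕ) : ℝ) := by push_cast; linarith
    have h3' : (A : ℝ) < (((a + 1) * q ^ j : ℕ) : ℝ) := by push_cast; linarith
    rw [Nat.cast_lt] at h2' h3'
    exact ⟨by omega, h3'⟩
  · rintro ⟨h2, h3⟩
    have h2' : ((a * q ^ j : ℕ) : ℝ) ≤ (A : ℝ) := by exact_mod_cast h2
    have h3' : ((A + 1 : ℕ) : ℝ) ≤ (((a + 1) * q ^ j : ℕ) : ℝ) := by exact_mod_cast h3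
    push_cast at h2' h3'
    exact ⟨by linarith, by linarith⟩

theorem IsBasicBox.exists_eq_pi {q : ℕ} (hq : 2 ≤ q) {d n : ℕ} {β : Set (Fin d → ℝ)}
    (h : IsBasicBox q β) (hvol : volume β = ((q : ℝ≥0∞) ^ n)⁻¹) :
    ∃ a k : Fin d → ℕ, (∀ i, a i < q ^ k i) ∧ ∑ i, k i = n ∧ β = Set.univ.pi fun i =>
      Set.Ico ((a i : ℝ) / (q : ℝ) ^ k i) (((a i : ℝ) + 1) / (q : ℝ) ^ k i) := by
  obtain ⟨I, hI, rfl⟩ := h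
  choose a k hlt hIeq using hI
  obtain rfl : I = fun i => Set.Ico ((a i : ℝ) / (q : ℝ) ^ k i) (((a i : ℝ) + 1) / (q : ℝ) ^ k i) :=
    funext hIeq
  refine ⟨a, k, hlt, ?_, rfl⟩
  have hq0 : (0 : ℝ) < q := by positivity
  rw [volume_pi_pi] at hvol
  have h1 : ∀ i, volume (Set.Ico ((a i : ℝ) / (q : ℝ) ^ k i) (((a i : ℝ) + 1) / (q : ℝ) ^ k i)) =
      ((q : ℝ≥0∞)⁻¹) ^ k i := fun i => by
    rw [Real.volume_Ico, ← sub_div, add_sub_cancel_left, one_div, ← inv_pow,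
      ENNReal.ofReal_pow (by positivity), ENNReal.ofReal_inv_of_pos hq0, ENNReal.ofReal_natCast]
  simp only [h1] at hvol
  rw [Finset.prod_pow_eq_pow_sum, ← ENNReal.inv_pow, inv_inj] at hvol
  have h2 : q ^ ∑ i, k i = q ^ n := by exact_mod_cast hvol
  exact Nat.pow_right_injective hq h2

/-- The point with the given base `q` digits, shifted by `θ` in units of the last place. -/
noncomputable def digitPoint (q L : ℕ) {d : ℕ} (δ : Fin d → ℕ → ℕ) (θ : ℝ) : Fin d → ℝ :=
  fun i => ((numeral q (δ i) L : ℝ) + θ) / (q : ℝ) ^ L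

theorem digitPoint_mem_iff {q L d : ℕ} {δ c : Fin d → ℕ → ℕ} (hδ : ∀ i l, δ i l < q)
    (hc : ∀ i l, c i l < q) {θ : ℝ} (h0 : 0 ≤ θ) (h1 : θ < 1) {i : Fin d} {k : ℕ} (hk : k ≤ L) :
    digitPoint q L δ θ i ∈ Set.Ico ((numeral q (c i) k : ℝ) / (q : ℝ) ^ k)
      (((numeral q (c i) k : ℝ) + 1) / (q : ℝ) ^ k) ↔ ∀ l < k, δ i l = c i l := by
  obtain ⟨j, rfl⟩ := Nat.exists_eq_add_of_le hk
  rw [digitPoint, add_div_pow_mem_Ico_iff ((Nat.zero_le _).trans_lt (hδ i 0)) _ _ _ _ h0 h1,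
    numeral_add_div (hδ i), numeral_eq_iff (hδ i) (hc i)]

theorem digitPoint_mem_Icc {q L d : ℕ} {δ : Fin d → ℕ → ℕ} (hδ : ∀ i l, δ i l < q) {θ : ℝ}
    (h0 : 0 ≤ θ) (h1 : θ < 1) : digitPoint q L δ θ ∈ Set.Icc (0 : Fin d → ℝ) 1 := by
  refine ⟨fun i => ?_, fun i => ?_⟩
  · simp only [digitPoint, Pi.zero_apply]; positivity
  · have hq : 0 < q := (Nat.zero_le _).trans_lt (hδ i 0)
    have : ((numeral q (δ i) L + 1 : ℕ) : ℝ) ≤ ((q ^ L : ℕ) : ℝ) := by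
      exact_mod_cast numeral_lt (hδ i) L
    push_cast at this
    simp only [digitPoint, Pi.one_apply]
    rw [div_le_one (by positivity)]
    linarith

theorem digitPoint_eq {q L d : ℕ} {δ δ' : Fin d → ℕ → ℕ} (hδ : ∀ i l, δ i l < q)
    (hδ' : ∀ i l, δ' i l < q) {θ θ' : ℝ} (h0 : 0 ≤ θ) (h1 : θ < 1) (h0' : 0 ≤ θ') (h1' : θ' < 1)
    (i : Fin d) (h : digitPoint q L δ θ = digitPoint q L δ' θ') :
    (∀ l < L, δ i l = δ' i l) ∧ θ = θ' := by
  have hq : 0 < q := (Nat.zero_le _).trans_lt (hδ i 0)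
  have hmem := (digitPoint_mem_iff (θ := θ) (L := L) (i := i) hδ hδ h0 h1 le_rfl).2 fun _ _ => rfl
  rw [h] at hmem
  have hd := (digitPoint_mem_iff hδ' hδ h0' h1' le_rfl).1 hmem
  have hi := congrFun h i
  simp only [digitPoint, (numeral_eq_iff (hδ' i) (hδ i) L).2 hd] at hi
  rw [div_left_inj' (by positivity)] at hi
  exact ⟨fun l hl => (hd l hl).symm, by linarith⟩

/-- A point set is equidistributed if its digits are. -/
theorem isEquidistributed_image {q L d n : ℕ} (hq : 2 ≤ q) {σ : Type*} [Fintype σ]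
    [DecidableEq (Fin d → ℝ)] {δ : σ → Fin d → ℕ → ℕ} {θ : σ → ℝ} (hδ : ∀ s i l, δ s i l < q)
    (h0 : ∀ s, 0 ≤ θ s) (h1 : ∀ s, θ s < 1)
    (hinj : Function.Injective fun s => digitPoint q L (δ s) (θ s)) (hn : n ≤ L) {m ε : ℝ}
    (h : ∀ (k : Fin d → ℕ) (c : Fin d → ℕ → ℕ), ∑ i, k i = n → (∀ i l, c i l < q) →
      (1 - ε) * m ≤ (Nat.card {s // ∀ i, ∀ l < k i, δ s i l = c i l} : ℝ) ∧
        (Nat.card {s // ∀ i, ∀ l < k i, δ s i l = c i l} : ℝ) ≤ (1 + ε) * m) :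
    IsEquidistributed q n m ε
      (Finset.univ.image fun s => digitPoint q L (δ s) (θ s)) := by
  intro β hβ hvol
  obtain ⟨a, k, ha, hk, rfl⟩ := hβ.exists_eq_pi hq hvol
  choose c hc hca using fun i => exists_numeral_eq (by omega : 0 < q) (k i) (a i) (ha i)
  have hkL : ∀ i, k i ≤ L := fun i =>
    (Finset.single_le_sum (fun _ _ => Nat.zero_le _) (Finset.mem_univ i)).trans (hk.le.trans hn)
  have hset : (Set.univ.pi fun i =>
      Set.Ico ((a i : ℝ) / (q : ℝ) ^ k i) (((a i : ℝ) + 1) / (q : ℝ) ^ k i)) ∩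
      ((Finset.univ.image fun s => digitPoint q L (δ s) (θ s) : Finset (Fin d → ℝ)) :
        Set (Fin d → ℝ)) =
      (fun s => digitPoint q L (δ s) (θ s)) '' {s | ∀ i, ∀ l < k i, δ s i l = c i l} := by
    have key : ∀ s, (digitPoint q L (δ s) (θ s) ∈ Set.univ.pi fun i =>
        Set.Ico ((a i : ℝ) / (q : ℝ) ^ k i) (((a i : ℝ) + 1) / (q : ℝ) ^ k i)) ↔
        ∀ i, ∀ l < k i, δ s i l = c i l := fun s => by
      simp only [Set.mem_univ_pi, ← hca]
      exact forall_congr' fun i => digitPoint_mem_iff (hδ s) hc (h0 s) (h1 s) (hkL i)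
    ext x
    simp only [Finset.coe_image, Finset.coe_univ, Set.image_univ, Set.mem_inter_iff,
      Set.mem_range, Set.mem_image, Set.mem_ofPred_eq]
    constructor
    · rintro ⟨hx, s, rfl⟩
      exact ⟨s, (key s).1 hx, rfl⟩
    · rintro ⟨s, hs, rfl⟩
      exact ⟨(key s).2 hs, s, rfl⟩
  rw [hset, Set.ncard_image_of_injective _ hinj]
  exact h k c hk hc

/-! ### Counting sampled polynomials in a box -/

open Polynomial in
theorem exists_coeff_eq {F : Type*} [Field F] (D : ℕ) {t : ℕ} (v : Fin t → F) :
    ∃ f ∈ degreeLT F (D + t), ∀ y : Fin t, f.coeff (D + y) = v y := by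
  refine ⟨X ^ D * ((degreeLTEquiv F t).symm v : F[X]), ?_, fun y => ?_⟩
  · have := (mul_mem_degreeLT_iff (monic_X_pow (R := F) D) (s := t)).2
      ((degreeLTEquiv F t).symm v).2
    rwa [natDegree_X_pow] at this
  · rw [add_comm, coeff_X_pow_mul]
    exact congrFun ((degreeLTEquiv F t).apply_symm_apply v) y

open Polynomial in
theorem mem_degreeLT_of_coeff_eq {F : Type*} [Field F] {D t : ℕ} {f f' : F[X]}
    (hf : f ∈ degreeLT F (D + t)) (hf' : f' ∈ degreeLT F (D + t))
    (h : ∀ y : Fin t, f.coeff (D + y) = f'.coeff (D + y)) : f - f' ∈ degreeLT F D := by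
  rw [mem_degreeLT, degree_lt_iff_coeff_zero]
  intro l hl
  obtain ⟨y, rfl⟩ := Nat.exists_eq_add_of_le hl
  rw [coeff_sub, sub_eq_zero]
  by_cases hy : y < t
  · exact h ⟨y, hy⟩
  · rw [mem_degreeLT, degree_lt_iff_coeff_zero] at hf hf'
    rw [hf _ (by omega), hf' _ (by omega)]

open Polynomial in
/-- Polynomials of degree `< D + t` whose `t` leading coefficients are in the sample `τ`, counted
with multiplicity. -/
abbrev Sampled {F : Type*} [Field F] (D : ℕ) {t K : ℕ} (τ : Fin K → Fin t → F) : Type _ :=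
  {s : degreeLT F (D + t) × Fin K // ∀ y : Fin t, (s.1 : F[X]).coeff (D + y) = τ s.2 y}

open Polynomial in
-- For each sample, subtracting one polynomial with the sampled top leaves all polynomials of degree
-- `< D` with other prescribed digits, and their number does not depend on which digits are
-- prescribed.
theorem card_sampled_digit_eq {F : Type*} [Field F] [Fintype F] {d e : ℕ} {p : Fin d → F[X]}
    (hp : ∀ i, (p i).Monic) (he : ∀ i, (p i).natDegree = e) (he0 : 0 < e)
    (hc : Pairwise fun i j => IsCoprime (p i) (p j)) {k J : Fin d → ℕ} (hk : ∀ i, k i ≤ e * J i)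
    {D t K : ℕ} (hD : e * ∑ i, J i ≤ D) (τ : Fin K → Fin t → F) (c : Fin d → ℕ → F) :
    Nat.card {s : Sampled D τ // ∀ i, ∀ l < k i, digit (p i) l (s.1.1 : F[X]) = c i l} =
      K * Fintype.card F ^ (D - ∑ i, k i) := by
  choose f hf hfτ using fun j => exists_coeff_eq D (τ j)
  have key : {s : Sampled D τ // ∀ i, ∀ l < k i, digit (p i) l (s.1.1 : F[X]) = c i l} ≃
      Σ j : Fin K, {g : degreeLT F D //
        ∀ i, ∀ l < k i, digit (p i) l (g : F[X]) = c i l - digit (p i) l (f j)} :=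
    { toFun := fun s => ⟨s.1.1.2, ⟨(s.1.1.1 : F[X]) - f s.1.1.2,
        mem_degreeLT_of_coeff_eq s.1.1.1.2 (hf _) fun y => by rw [s.1.2, hfτ]⟩, fun i l hl => by
          rw [digit_sub (hp i), s.2 i l hl]⟩
      invFun := fun g => ⟨⟨(⟨f g.1 + (g.2.1 : F[X]), Submodule.add_mem _ (hf _)
        (degreeLT_mono (Nat.le_add_right _ _) g.2.1.2)⟩, g.1), fun y => by
          have := g.2.1.2
          rw [mem_degreeLT, degree_lt_iff_coeff_zero] at this
          simp only [coeff_add, hfτ]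
          rw [this _ (by omega), add_zero]⟩, fun i l hl => by
          simp only [digit_add (hp i)]
          rw [g.2.2 i l hl, add_sub_cancel]⟩
      left_inv := fun s => by
        refine Subtype.ext (Subtype.ext (Prod.ext (Subtype.ext ?_) rfl))
        exact add_sub_cancel _ _
      right_inv := fun g => by
        obtain ⟨j, ⟨g, hg⟩, hg'⟩ := g
        refine Sigma.ext rfl (heq_of_eq (Subtype.ext (Subtype.ext ?_)))
        exact add_sub_cancel_left _ _ }
  rw [Nat.card_congr key, Nat.card_sigma,
    Finset.sum_congr rfl fun j _ => card_digit_eq hp he he0 hc hk hD _]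
  simp

open Polynomial in
theorem card_sampled_digit_eq_card_filter {F : Type*} [Field F] {d e : ℕ}
    {p : Fin d → F[X]} (hp : ∀ i, (p i).Monic) (he : ∀ i, (p i).natDegree = e) (he0 : 0 < e)
    (hc : Pairwise fun i j => IsCoprime (p i) (p j)) {k : Fin d → ℕ} {D t K : ℕ}
    (hD : D ≤ e * ∑ i, k i / e) (τ : Fin K → Fin t → F) {c : Fin d → ℕ → F}
    {W : Finset (Fin t → F)} [DecidableEq (Fin t → F)]
    (hW : ∀ w, w ∈ W ↔ ∃ f ∈ degreeLT F (D + t),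
      (∀ i, ∀ l < k i, digit (p i) l f = c i l) ∧ ∀ y : Fin t, w y = f.coeff (D + y)) :
    Nat.card {s : Sampled D τ // ∀ i, ∀ l < k i, digit (p i) l (s.1.1 : F[X]) = c i l} =
      (Finset.univ.filter fun j => τ j ∈ W).card := by
  rw [← Fintype.card_subtype, ← Nat.card_eq_fintype_card]
  refine Nat.card_eq_of_bijective (fun s => ⟨s.1.1.2, (hW _).2 ⟨s.1.1.1, s.1.1.1.2, s.2,
    fun y => (s.1.2 y).symm⟩⟩) ⟨fun s s' h => ?_, fun j => ?_⟩
  · have hj : s.1.1.2 = s'.1.1.2 := congrArg Subtype.val h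
    refine Subtype.ext (Subtype.ext (Prod.ext (Subtype.ext ?_) hj))
    refine eq_of_coeff_eq_of_digit_eq hp he he0 hc hD s.1.1.1.2 s'.1.1.1.2
      (fun i l hl => (s.2 i l hl).trans (s'.2 i l hl).symm) fun y => ?_
    rw [s.1.2, s'.1.2, hj]
  · obtain ⟨f, hf, hfc, hfτ⟩ := (hW _).1 j.2
    exact ⟨⟨⟨(⟨f, hf⟩, j.1), fun y => (hfτ y).symm⟩, hfc⟩, rfl⟩

open Polynomial in
theorem card_leading_eq {F : Type*} [Field F] [Fintype F] {d e : ℕ}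
    {p : Fin d → F[X]} (hp : ∀ i, (p i).Monic) (he : ∀ i, (p i).natDegree = e) (he0 : 0 < e)
    (hc : Pairwise fun i j => IsCoprime (p i) (p j)) {k J : Fin d → ℕ} {D t : ℕ}
    (hk : ∀ i, k i ≤ e * J i) (hD : D ≤ e * ∑ i, k i / e) (hJ : e * ∑ i, J i ≤ D + t)
    {c : Fin d → ℕ → F} {W : Finset (Fin t → F)}
    (hW : ∀ w, w ∈ W ↔ ∃ f ∈ degreeLT F (D + t),
      (∀ i, ∀ l < k i, digit (p i) l f = c i l) ∧ ∀ y : Fin t, w y = f.coeff (D + y)) :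
    W.card = Fintype.card F ^ (D + t - ∑ i, k i) := by
  rw [← card_digit_eq hp he he0 hc hk hJ c, ← Fintype.card_coe,
    ← Nat.card_eq_fintype_card]
  symm
  refine Nat.card_eq_of_bijective (fun f => ⟨fun y => (f.1 : F[X]).coeff (D + y),
    (hW _).2 ⟨f.1, f.1.2, f.2, fun _ => rfl⟩⟩) ⟨fun f f' h => ?_, fun w => ?_⟩
  · refine Subtype.ext (Subtype.ext ?_)
    exact eq_of_coeff_eq_of_digit_eq hp he he0 hc hD f.1.2 f'.1.2
      (fun i l hl => (f.2 i l hl).trans (f'.2 i l hl).symm)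
      fun y => congrFun (congrArg Subtype.val h) y
  · obtain ⟨f, hf, hfc, hfw⟩ := (hW _).1 w.2
    exact ⟨⟨⟨f, hf⟩, hfc⟩, Subtype.ext (funext fun y => (hfw y).symm)⟩

/-! ### Choice of parameters and conclusion -/

theorem exists_degree (q d : ℕ) (hq : 2 ≤ q) (hd : 2 ≤ d) :
    ∃ e : ℕ, 0 < e ∧ e * d ≤ q ^ e ∧ q ^ e ≤ (d * q) ^ 2 := by
  have hd2 : d ^ 2 ≠ 0 := by positivity
  refine ⟨Nat.log q (d ^ 2) + 2, by omega, ?_, ?_⟩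
  · set a := Nat.log q (d ^ 2)
    have h1 : d ^ 2 < q ^ (a + 1) := Nat.lt_pow_succ_log_self hq _
    have h2 : 2 * d ^ 2 ≤ q ^ (a + 2) := by rw [pow_succ' q (a + 1)]; nlinarith
    have h3 : ∀ b : ℕ, (b + 2) ^ 2 ≤ 2 * 2 ^ (b + 2) := fun b => by
      induction b with
      | zero => norm_num
      | succ b ih =>
        rcases b with _ | b
        · norm_num
        · rw [show b + 1 + 1 + 2 = b + 1 + 2 + 1 by ring, pow_succ 2 (b + 1 + 2)]
          generalize 2 ^ (b + 1 + 2) = x at ih ⊢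
          have : (b + 1 + 2 + 1) ^ 2 + (b ^ 2 + 4 * b + 2) = 2 * (b + 1 + 2) ^ 2 := by ring
          omega
    have h4 : (a + 2) ^ 2 ≤ 2 * q ^ (a + 2) := (h3 a).trans (by gcongr)
    -- Multiplying `e² ≤ 2 q^e` by `2 d² ≤ q^e` gives `(e d)² ≤ (q^e)²`.
    refine Nat.mul_self_le_mul_self_iff.1 ?_
    nlinarith [Nat.mul_le_mul h4 h2]
  · have h1 : q ^ Nat.log q (d ^ 2) ≤ d ^ 2 := Nat.pow_log_le_self q hd2
    rw [pow_add, mul_pow]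
    gcongr

open Polynomial in
theorem exists_almostNet {q d m n : ℕ} (hq : q.Prime) (hd : 2 ≤ d) {ε : ℝ} (hε : 0 < ε)
    (hε' : ε ≤ 1) (h : 96 * ((d : ℝ) * Real.log ((d : ℝ) * (q : ℝ))) ≤ ε ^ 2 * m) :
    ∃ P : Finset (Fin d → ℝ), (P : Set (Fin d → ℝ)) ⊆ Set.Icc 0 1 ∧ P.card = m * q ^ n ∧
      IsEquidistributed q n (m : ℝ) ε P ∧
      ∃ M : ℕ, M ≤ d ^ (4 * d) * q ^ (6 * d) * m ∧ IsAlmostNet q (M : ℝ) 0 P := by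
  classical
  have : Fact q.Prime := ⟨hq⟩
  have hq2 := hq.two_le
  obtain ⟨e, he0, hed, hqe⟩ := exists_degree q d hq2 hd
  obtain ⟨p, hp, he, hc⟩ := exists_pairwise_coprime_monic q d e he0 hed
  have hJle : ∀ k : Fin d → ℕ, ∀ i, k i ≤ e * (k i / e + 1) := fun k i => by
    have := Nat.div_add_mod (k i) e
    have := Nat.mod_lt (k i) he0
    rw [mul_add]; omega
  have hJsum : ∀ k : Fin d → ℕ, e * ∑ i, (k i / e + 1) = e * ∑ i, k i / e + e * d := fun k => by
    simp [Finset.sum_add_distrib, mul_add]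
  have hsum_le : ∀ k : Fin d → ℕ, e * ∑ i, k i / e ≤ ∑ i, k i := fun k => by
    rw [Finset.mul_sum]; exact Finset.sum_le_sum fun i _ => Nat.mul_div_le _ _
  have hle_sum : ∀ k : Fin d → ℕ, ∑ i, k i ≤ e * ∑ i, k i / e + e * d := fun k => by
    rw [← hJsum, Finset.mul_sum]; exact Finset.sum_le_sum fun i _ => hJle k i
  -- Truncated subtraction is intended: for `n < e * d` all coefficients are sampled.
  obtain ⟨D, hD⟩ : ∃ D, D = n - e * d := ⟨_, rfl⟩
  obtain ⟨t, ht⟩ : ∃ t, D + t = n + e * d := ⟨n + e * d - D, by omega⟩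
  -- This makes `K * q ^ D = m * q ^ n` points in all, and a set of `q ^ (D + t - n)` tops out of `q
  -- ^ t` is hit `m` times on average.
  set K := m * q ^ (n - D) with hK
  let W : BoxCode (ZMod q) d e t → Finset (Fin t → ZMod q) := fun κ => (κ.toSet p).toFinset
  have : Finite (BoxCode (ZMod q) d e t) := inferInstance
  have : Fintype (BoxCode (ZMod q) d e t) := Fintype.ofFinite _
  have hdq : (1 : ℝ) < (d : ℝ) * q := by
    have h1 : (2 : ℝ) ≤ d := by exact_mod_cast hd
    have h2 : (2 : ℝ) ≤ q := by exact_mod_cast hq2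
    nlinarith
  -- The constant `96 = 4 * 24` arises here: `20 * d` in the exponent for the codes and a generous
  -- `4 * d` for the factor `2`.
  have hcodes : 2 * (Fintype.card (BoxCode (ZMod q) d e t) : ℝ) < Real.exp (ε ^ 2 * m / 4) := by
    have h1 : Fintype.card (BoxCode (ZMod q) d e t) ≤ (d * q) ^ (20 * d) := by
      rw [← Nat.card_eq_fintype_card]
      refine (card_boxCode_le (by omega)).trans ?_
      rw [ZMod.card, show 20 * d = 2 * (10 * d) by ring, pow_mul _ 2]
      exact Nat.pow_le_pow_left hqe _
    have h1' : (Fintype.card (BoxCode (ZMod q) d e t) : ℝ) ≤ ((d : ℝ) * q) ^ (20 * d) := by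
      exact_mod_cast h1
    have h2 : ((d : ℝ) * q) ^ (24 * d) ≤ Real.exp (ε ^ 2 * m / 4) := by
      rw [← Real.exp_log (by positivity : 0 < ((d : ℝ) * q) ^ (24 * d)), Real.log_pow]
      gcongr
      push_cast
      linarith
    have h3 : (2 : ℝ) < ((d : ℝ) * q) ^ (4 * d) := by
      have : 2 < (d * q) ^ (4 * d) := by
        calc 2 < (2 * 2) ^ 1 := by norm_num
          _ ≤ (d * q) ^ 1 := by gcongr
          _ ≤ _ := Nat.pow_le_pow_right (by positivity) (by omega)
      exact_mod_cast this
    refine lt_of_lt_of_le ?_ h2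
    rw [show 24 * d = 4 * d + 20 * d by ring, pow_add]
    calc _ ≤ 2 * ((d : ℝ) * q) ^ (20 * d) := by gcongr
      _ < _ := by gcongr
  -- Codes whose set has the wrong size come from no box of volume `q^{-n}` and are discarded.
  obtain ⟨τ, hτ⟩ := exists_sample (K := K) (m := m) W
    (Finset.univ.filter fun κ => (K : ℝ) * (W κ).card = m * Fintype.card (Fin t → ZMod q))
    (by positivity) hε hε' (by simp) hcodes
  let δ : Sampled D τ → Fin d → ℕ → ℕ := fun s i l => (digit (p i) l (s.1.1 : (ZMod q)[X])).val
  -- A shift below one unit of the last place separates repeated samples without changing any of the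
  -- first `L` digits.
  let θ : Sampled D τ → ℝ := fun s => (s.1.2 : ℕ) / (K : ℝ)
  have hδ : ∀ s i l, δ s i l < q := fun s i l => ZMod.val_lt _
  have hθ0 : ∀ s, 0 ≤ θ s := fun s => by positivity
  have hKpos : ∀ s : Sampled D τ, (0 : ℝ) < K := fun s => by
    have := s.1.2.2
    exact_mod_cast (Nat.zero_le _).trans_lt this
  have hθ1 : ∀ s, θ s < 1 := fun s => by
    rw [div_lt_one (hKpos s)]
    exact_mod_cast s.1.2.2
  have hcount : ∀ (k : Fin d → ℕ) (c : Fin d → ℕ → ℕ), (∀ i l, c i l < q) →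
      Nat.card {s // ∀ i, ∀ l < k i, δ s i l = c i l} =
      Nat.card {s : Sampled D τ //
        ∀ i, ∀ l < k i, digit (p i) l (s.1.1 : (ZMod q)[X]) = (c i l : ZMod q)} :=
    fun k c hcq => Nat.card_congr <| Equiv.subtypeEquivRight fun s =>
      forall_congr' fun i => forall_congr' fun l => imp_congr_right fun _ => by
        rw [← (ZMod.val_injective q).eq_iff, ZMod.val_natCast_of_lt (hcq i l)]
  -- With this many digits a single coordinate determines `f` modulo `p i ^ (D + t)`, hence `f`
  -- itself.
  obtain ⟨L, hL⟩ : ∃ L, L = e * (D + t) := ⟨_, rfl⟩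
  have hnL : n ≤ L := by
    rw [hL, ht]; nlinarith
  have hinj : Function.Injective fun s => digitPoint q L (δ s) (θ s) := by
    intro s s' hss
    obtain ⟨h1, h2⟩ := digitPoint_eq (hδ s) (hδ s') (hθ0 s) (hθ1 s) (hθ0 s') (hθ1 s')
      (⟨0, by omega⟩ : Fin d) hss
    have hj : s.1.2 = s'.1.2 := by
      have := (div_left_inj' (hKpos s).ne').1 h2
      exact Fin.ext (by exact_mod_cast this)
    refine Subtype.ext (Prod.ext (Subtype.ext ?_) hj)
    rw [← sub_eq_zero]
    have hp0 := hp ⟨0, by omega⟩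
    have he' := he ⟨0, by omega⟩
    refine eq_zero_of_dvd_of_mem_degreeLT (G := p ⟨0, by omega⟩ ^ (D + t)) ?_
      ((forall_digit_eq_zero_iff hp0 (by omega) (D + t) _).1 fun l hl => ?_)
      (Submodule.sub_mem _ s.1.1.2 s'.1.1.2)
    · rw [hp0.natDegree_pow, he']
      exact Nat.le_mul_of_pos_right _ he0
    · rw [digit_sub hp0, sub_eq_zero]
      exact ZMod.val_injective q (h1 l (by rw [hL, ← he']; exact hl))
  have hfin : Finite (Sampled D τ) := inferInstance
  have : Fintype (Sampled D τ) := Fintype.ofFinite _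
  have hcard : Nat.card (Sampled D τ) = K * q ^ D := by
    have := card_sampled_digit_eq (D := D) hp he he0 hc (k := fun _ => 0) (J := fun _ => 0) (by simp)
      (by simp) τ fun _ _ => 0
    rw [← Nat.card_congr (Equiv.subtypeUnivEquiv (by simp) :
      {s : Sampled D τ // ∀ i : Fin d, ∀ l < 0, digit (p i) l (s.1.1 : (ZMod q)[X]) = 0} ≃ _)]
    simpa using this
  have hPcard : (Finset.univ.image fun s => digitPoint q L (δ s) (θ s)).card = m * q ^ n := by
    rw [Finset.card_image_of_injective _ hinj, Finset.card_univ, ← Nat.card_eq_fintype_card,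
      hcard, hK, mul_assoc, ← pow_add, Nat.sub_add_cancel (by omega)]
  have hPsub : ((Finset.univ.image fun s => digitPoint q L (δ s) (θ s) :
      Finset (Fin d → ℝ)) : Set (Fin d → ℝ)) ⊆ Set.Icc 0 1 := by
    intro x hx
    obtain ⟨s, -, rfl⟩ := Finset.mem_image.1 (Finset.mem_coe.1 hx)
    exact digitPoint_mem_Icc (hδ s) (hθ0 s) (hθ1 s)
  refine ⟨Finset.univ.image fun s => digitPoint q L (δ s) (θ s), hPsub, hPcard, ?_,
    m * q ^ (n - (D - e * d)), ?_, hPsub, D - e * d, ?_, ?_⟩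
  · refine isEquidistributed_image hq2 hδ hθ0 hθ1 hinj hnL fun k c hk hcq => ?_
    rw [hcount k c hcq]
    have h1 := hsum_le k
    have h2 := hle_sum k
    have hD1 : D ≤ e * ∑ i, k i / e := by omega
    have hJ : e * ∑ i, (k i / e + 1) ≤ D + t := by rw [hJsum]; omega
    obtain ⟨f₀, hf₀, hf₀'⟩ := exists_digit_eq hp he he0 hc (hJle k) hJ
      fun i l => (c i l : ZMod q)
    obtain ⟨κ, hκ⟩ := exists_code hp he he0 hc hD1 (by omega) hf₀ hf₀'
    have hκW : ∀ w, w ∈ W κ ↔ _ := fun w => Set.mem_toFinset.trans (hκ w)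
    rw [card_sampled_digit_eq_card_filter hp he he0 hc hD1 τ hκW]
    refine hτ κ (Finset.mem_filter.2 ⟨Finset.mem_univ _, ?_⟩)
    rw [card_leading_eq hp he he0 hc (hJle k) hD1 hJ hκW, ZMod.card, hk, Fintype.card_fun,
      ZMod.card, Fintype.card_fin, hK]
    have : q ^ (n - D) * q ^ (D + t - n) = q ^ t := by
      rw [← pow_add]; congr 1; omega
    rw [← this]
    push_cast
    ring
  · calc m * q ^ (n - (D - e * d)) ≤ m * q ^ (e * (2 * d)) := by
          gcongr
          · exact hq.one_le
          · have : e * (2 * d) = 2 * (e * d) := by ring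
            omega
      _ = m * (q ^ e) ^ (2 * d) := by rw [pow_mul]
      _ ≤ m * ((d * q) ^ 2) ^ (2 * d) := by gcongr
      _ = d ^ (4 * d) * q ^ (4 * d) * m := by
          rw [← pow_mul, mul_pow]; ring_nf
      _ ≤ _ := by
          gcongr
          · exact hq.one_le
          · norm_num
  · rw [hPcard]
    have : m * q ^ n = q ^ (D - e * d) * (m * q ^ (n - (D - e * d))) := by
      rw [mul_left_comm, ← pow_add, Nat.add_sub_cancel' (by omega)]
    exact_mod_cast this
  · refine isEquidistributed_image hq2 hδ hθ0 hθ1 hinj (by omega) fun k c hk hcq => ?_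
    -- Rounding up to complete blocks costs at most `e * d`, exactly the margin left below `D`; if
    -- `D < e * d`, the box is the whole half-open cube.
    have hex : ∃ J : Fin d → ℕ, (∀ i, k i ≤ e * J i) ∧ e * ∑ i, J i ≤ D := by
      by_cases hDe : e * d ≤ D
      · refine ⟨fun i => k i / e + 1, hJle k, ?_⟩
        rw [hJsum]
        have := hsum_le k
        omega
      · have h0 : ∑ i, k i = 0 := by omega
        rw [Finset.sum_eq_zero_iff] at h0
        exact ⟨fun _ => 0, fun i => by simp [h0 i (Finset.mem_univ i)], by simp⟩
    obtain ⟨J, hkJ, hJD⟩ := hex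
    rw [hcount k c hcq, card_sampled_digit_eq hp he he0 hc hkJ hJD, ZMod.card, hk, hK]
    have : m * q ^ (n - D) * q ^ (D - (D - e * d)) = m * q ^ (n - (D - e * d)) := by
      rw [mul_assoc, ← pow_add]; congr 2; omega
    rw [this]
    simp

theorem theorem1 (q d : ℕ) (hq : q.Prime) (hd : 2 ≤ d) :
    (∀ m n : ℕ, 0 < n → 400 * (d : ℝ) * Real.log ((d : ℝ) * (q : ℝ)) ≤ (m : ℝ) →
      ∃ P : Finset (Fin d → ℝ),
        (P : Set (Fin d → ℝ)) ⊆ Set.Icc 0 1 ∧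
        P.card = m * q ^ n ∧
        IsEquidistributed q n (m : ℝ)
          (10 * Real.sqrt ((d : ℝ) * Real.log ((d : ℝ) * (q : ℝ)) / (m : ℝ))) P ∧
        ∃ M : ℕ, M ≤ d ^ (4 * d) * q ^ (6 * d) * m ∧ IsAlmostNet q (M : ℝ) 0 P) ∧
    (∀ ε : ℝ, 0 < ε → ε < 1 / 2 →
      ∃ m : ℕ, 0 < m ∧
        (m : ℝ) ≤ 100 * (ε ^ 2)⁻¹ * (d : ℝ) * Real.log ((d : ℝ) * (q : ℝ)) ∧
        ∀ N : ℕ, ∃ P : Finset (Fin d → ℝ), N ≤ P.card ∧ IsAlmostNet q (m : ℝ) ε P) := by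
  have hd' : (2 : ℝ) ≤ d := by exact_mod_cast hd
  have hq' : (2 : ℝ) ≤ q := by exact_mod_cast hq.two_le
  have hlog : 1 ≤ Real.log ((d : ℝ) * (q : ℝ)) := by
    rw [Real.le_log_iff_exp_le (by positivity)]
    nlinarith [Real.exp_one_lt_d9]
  set A := (d : ℝ) * Real.log ((d : ℝ) * (q : ℝ)) with hA
  have hA2 : 2 ≤ A := by nlinarith
  refine ⟨fun m n _ hm => ?_, fun ε hε hε' => ?_⟩
  · have hm' : 400 * A ≤ m := by rw [hA, ← mul_assoc]; exact hm
    have hm0 : (0 : ℝ) < m := by linarith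
    have hAm : A / m ≤ (1 / 20) ^ 2 := by rw [div_le_iff₀ hm0]; linarith
    have hs : Real.sqrt (A / m) ≤ 1 / 20 := Real.sqrt_le_iff.2 ⟨by norm_num, hAm⟩
    refine exists_almostNet hq hd (by positivity) (by linarith) ?_
    rw [mul_pow, Real.sq_sqrt (by positivity), mul_assoc, div_mul_cancel₀ _ hm0.ne', ← hA]
    linarith
  · set x := 100 * (ε ^ 2)⁻¹ * A with hx
    have hεx : ε ^ 2 * x = 100 * A := by rw [hx]; field_simp
    have hε2 : ε ^ 2 ≤ 1 := by nlinarith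
    have hx0 : 0 ≤ x := by positivity
    -- The floor costs at most `1`, covered by the gap between `100 * A` and `96 * A` since `A ≥ 2`.
    have hfl : ε ^ 2 * x - 1 ≤ ε ^ 2 * ⌊x⌋₊ := by
      have := Nat.lt_floor_add_one x
      have : ε ^ 2 * (x - 1) ≤ ε ^ 2 * ⌊x⌋₊ := by gcongr; linarith
      linarith
    have hpos : 0 < ⌊x⌋₊ := by
      rw [Nat.floor_pos]
      nlinarith
    refine ⟨⌊x⌋₊, hpos, (Nat.floor_le hx0).trans_eq (by rw [hx, hA]; ring), fun N => ?_⟩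
    obtain ⟨P, hP, hcard, heq, -⟩ := exists_almostNet (m := ⌊x⌋₊) (n := N) hq hd hε (by linarith)
      (by rw [← hA]; linarith)
    refine ⟨P, ?_, hP, N, ?_, heq⟩
    · rw [hcard]
      exact (Nat.lt_pow_self hq.one_lt).le.trans (Nat.le_mul_of_pos_left _ hpos)
    · rw [hcard]; push_cast; ring
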